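/- An instance of planar three-dimensional matching (P3DM) consists of pairwise disjoint finite sets $X,Y,Z$ with $|X|=|Y|=|Z|=q$ and a set $T\subseteq X\times Y\times Z$ such that every element of $X\cup Y\cup Z$ occurs in at most three triples of $T$, and such that the graph with vertex set $(X\cup Y\cup Z)\sqcup T$, in which each triple is adjacent to its three elements, is planar. Its answer is YES if there is $T'\subseteq T$ such that each element of $X\cup Y\cup Z$ is contained in exactly one triple of $T'$. A graph $G_{TP}$ of the instance is obtained as follows. Take a rectilinear layout of the above planar graph: vertices at distinct integer points, edges drawn without crossings along horizontal and vertical grid segments. Multiply all coordinates by $1000$. Each element stays as an *element point*. Each triple is replaced, in place (its vertices differ by at most $4$ in each coordinate from the scaled position), by a *triple triangle*: a triangle with side lengths $3,4,5$, integer vertices and axis-parallel legs, whose three vertices represent the three elements of the triple. Each edge is replaced by a *triangle path* from the element point to the vertex of the triple triangle that represents the element: a sequence of $k\ge 2$ axis-parallel $3\times 4$ rectangles with corners $J_i,J_{i+1}$ opposite in the $i$-th rectangle ($0\le i<k$), where $J_0$ is the element point and $J_k$ the vertex of the triple triangle; the $i$-th rectangle is cut by its diagonal not containing $J_i,J_{i+1}$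 into two 3-4-5 triangles, first the one at $J_i$, then the one at $J_{i+1}$. The first rectangle has its longer side vertical, the second one horizontal, the others are arbitrary. All triangles are pairwise different and form a plane figure (two of them meet only in common vertices or a common side); in particular consecutive rectangles of a path are connected at one or two vertices, and the first two at just one. All vertices are distributed over three disjoint sets $P_1,P_2,P_3$ so that the three vertices of every triangle lie in three different sets. In these sets each element point, each vertex of a triple triangle and each $J_i$ with $0<i<k$ of each path is listed once, and each of the two other corners of a rectangle is listed once for each rectangle of a triangle path of which it is such a corner (so a vertex, other than an element point, that is shared by two paths is listed twice). A *pattern of alternating triangles* in $G_{TP}$ is a partition of the listed points of $P_1,P_2,P_3$ into triples (triangles) with one point in each of the three sets, with total circumference $12n$, where $n$ is the number of triples in the partition, such that along each triangle path the triangles that belong to the partition are either exactly the first, third, fifth, … or exactly the second, fourth, sixth, … ones. **Proposition.** For every instance of P3DM and every graph $G_{TP}$ constructed from it, there exists a pattern of alternating triangles in $G_{TP}$ if and only if the instance has answer YES. -/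

import Mathlib

/-- A simple graph is planar: its vertices can be placed at distinct points of the plane and its
edges drawn as simple arcs between their end points, such that no arc passes through a vertex in
its interior and no two arcs cross. -/
def IsPlanar {V : Type*} (G : SimpleGraph V) : Prop :=
  ∃ (pos : V → ℝ × ℝ) (arc : G.edgeSet → C(unitInterval, ℝ × ℝ)),
    Function.Injective pos ∧
    (∀ e, Function.Injective (arc e)) ∧
    (∀ e, s(arc e 0, arc e 1) = Sym2.map pos e.1) ∧
    (∀ e, ∀ t ∈ Set.Ioo (0 : unitInterval) 1, ∀ v, arc e t ≠ pos v) ∧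
    (∀ e f, e ≠ f → ∀ s ∈ Set.Ioo (0 : unitInterval) 1, ∀ t ∈ Set.Ioo (0 : unitInterval) 1,
      arc e s ≠ arc f t)

/-- The three elements of a triple, as elements of the disjoint union of `X`, `Y` and `Z`. -/
def member {X Y Z : Type*} (t : X × Y × Z) : Fin 3 → X ⊕ Y ⊕ Z :=
  ![Sum.inl t.1, Sum.inr (Sum.inl t.2.1), Sum.inr (Sum.inr t.2.2)]

/-- The graph induced by a set of triples: one vertex for each element and for each triple, and
an edge between each triple and each of its elements. -/
def inducedGraph {X Y Z : Type*} (T : Finset (X × Y × Z)) : SimpleGraph ((X ⊕ Y ⊕ Z) ⊕ T) :=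
  SimpleGraph.fromRel fun a b =>
    ∃ (t : T) (i : Fin 3), a = Sum.inl (member t.1 i) ∧ b = Sum.inr t

/-- An instance of planar three-dimensional matching. The types `X`, `Y`, `Z` are the three
pairwise disjoint sets. -/
structure P3DM (X Y Z : Type*) [Fintype X] [Fintype Y] [Fintype Z] where
  q : ℕ
  card_X : Fintype.card X = q
  card_Y : Fintype.card Y = q
  card_Z : Fintype.card Z = q
  T : Finset (X × Y × Z)
  occurs_le_three : ∀ e : X ⊕ Y ⊕ Z, {t | t ∈ T ∧ ∃ i, member t i = e}.ncard ≤ 3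
  planar : IsPlanar (inducedGraph T)

namespace P3DM

variable {X Y Z : Type*} [Fintype X] [Fintype Y] [Fintype Z]

/-- The instance has answer YES: some set of triples contains every element exactly once. -/
def IsYes (I : P3DM X Y Z) : Prop :=
  ∃ T' ⊆ I.T, ∀ e : X ⊕ Y ⊕ Z, ∃! t, t ∈ T' ∧ ∃ i, member t i = e

/-- The edges of the induced graph: `(t, i)` joins the triple `t` to its `i`-th element. -/
abbrev Edge (I : P3DM X Y Z) : Type _ := I.T × Fin 3

/-- The element at which an edge of the induced graph starts. -/
def Edge.elem {I : P3DM X Y Z} (p : I.Edge) : X ⊕ Y ⊕ Z := member p.1.1 p.2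

end P3DM

/-- A rectilinear layout of the induced graph: the vertices are placed at distinct points of the
integer grid, and every edge is drawn along horizontal and vertical unit segments of the grid,
without crossings. The edge `p` visits the grid points `route p 0`, …, `route p (len p)`. -/
structure RectilinearLayout {X Y Z : Type*} [Fintype X] [Fintype Y] [Fintype Z]
    (I : P3DM X Y Z) where
  pos : (X ⊕ Y ⊕ Z) ⊕ I.T → ℤ × ℤ
  pos_injective : Function.Injective pos
  len : I.Edge → ℕ
  route : I.Edge → ℕ → ℤ × ℤ
  route_zero : ∀ p, route p 0 = pos (Sum.inl p.elem)
  route_len : ∀ p, route p (len p) = pos (Sum.inr p.1)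
  route_step : ∀ p, ∀ j < len p,
    |(route p (j + 1)).1 - (route p j).1| + |(route p (j + 1)).2 - (route p j).2| = 1
  route_simple : ∀ p, ∀ j ≤ len p, ∀ j' ≤ len p, route p j = route p j' → j = j'
  route_avoids : ∀ p j, 0 < j → j < len p → ∀ v, route p j ≠ pos v
  route_disjoint : ∀ p p', p ≠ p' → ∀ j j', 0 < j → j < len p → 0 < j' → j' < len p' →
    route p j ≠ route p' j'

/-- `a`, `b`, `c` are the vertices of a 3-4-5 triangle with a horizontal leg `ab` and a vertical
leg `ac`. -/
def IsTriangle345 (a b c : ℤ × ℤ) : Prop :=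
  b.2 = a.2 ∧ c.1 = a.1 ∧
    ((|b.1 - a.1| = 3 ∧ |c.2 - a.2| = 4) ∨ (|b.1 - a.1| = 4 ∧ |c.2 - a.2| = 3))

/-- The points `a` and `b` are opposite corners of a vertically oriented 3 by 4 rectangle. -/
def IsVertical (a b : ℤ × ℤ) : Prop := |b.1 - a.1| = 3 ∧ |b.2 - a.2| = 4

/-- The points `a` and `b` are opposite corners of a horizontally oriented 4 by 3 rectangle. -/
def IsHorizontal (a b : ℤ × ℤ) : Prop := |b.1 - a.1| = 4 ∧ |b.2 - a.2| = 3

/-- The two corners, other than `a` and `b`, of the axis-parallel rectangle with opposite corners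
`a` and `b`. -/
def side (a b : ℤ × ℤ) : Bool → ℤ × ℤ
  | false => (a.1, b.2)
  | true => (b.1, a.2)

/-- A system of triangle paths. Every triple is replaced by a triple triangle, whose vertex
`tripleVertex t i` represents the `i`-th element of `t`. Every edge `p` is replaced by a path of
`pairs p` rectangular pairs of triangles. The `i`-th pair fills the rectangle with opposite
corners `joint p i` and `joint p (i + 1)`, and is cut into two triangles by the other diagonal. -/
structure TrianglePaths {X Y Z : Type*} [Fintype X] [Fintype Y] [Fintype Z]
    (I : P3DM X Y Z) where
  tripleVertex : I.T → Fin 3 → ℤ × ℤ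
  pairs : I.Edge → ℕ
  joint : I.Edge → ℕ → ℤ × ℤ

namespace TrianglePaths

variable {X Y Z : Type*} [Fintype X] [Fintype Y] [Fintype Z] {I : P3DM X Y Z}

/-- The `j`-th triangle, `j = 0, …, 2 * pairs p - 1`, of the path `p`, counted from the element
point; the triangles number `2 * i` and `2 * i + 1` form the `i`-th pair. They share the diagonal
between the two `side` corners; the third vertex of the former is `joint p i`, and the third
vertex of the latter is `joint p (i + 1)`. -/
def pathTriangle (D : TrianglePaths I) (p : I.Edge) (j : ℕ) : Fin 3 → ℤ × ℤ :=
  ![D.joint p ((j + 1) / 2),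
    side (D.joint p (j / 2)) (D.joint p (j / 2 + 1)) false,
    side (D.joint p (j / 2)) (D.joint p (j / 2 + 1)) true]

/-- The names of all triangles: those of the triangle paths, and the triple triangles. -/
abbrev Triangle (D : TrianglePaths I) : Type _ :=
  ((p : I.Edge) × Fin (2 * D.pairs p)) ⊕ I.T

/-- The vertices of a triangle. -/
def vertex (D : TrianglePaths I) : D.Triangle → Fin 3 → ℤ × ℤ
  | Sum.inl ⟨p, j⟩ => D.pathTriangle p j
  | Sum.inr t => D.tripleVertex t

/-- The vertex set of a triangle, as a set of points of the real plane. -/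
def vertexSet (D : TrianglePaths I) (a : D.Triangle) : Set (ℝ × ℝ) :=
  Set.range fun k => (((D.vertex a k).1 : ℝ), ((D.vertex a k).2 : ℝ))

end TrianglePaths

/-- A graph `G_TP` of an instance of planar three-dimensional matching, given by its triangles:
its vertices are the element points and the vertices of the triangles, its edges the sides of the
triangles. -/
structure TrianglePathGraph {X Y Z : Type*} [Fintype X] [Fintype Y] [Fintype Z]
    (I : P3DM X Y Z) extends TrianglePaths I where
  /-- the rectilinear layout; its coordinates get multiplied by 1000 -/
  layout : RectilinearLayout I
  /-- a vertex at `z` belongs to the set `P_c` of index `c = colour z` -/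
  colour : ℤ × ℤ → Fin 3
  /-- triple triangles are 3-4-5 triangles with axis-parallel legs -/
  triple_345 : ∀ t, ∃ σ : Equiv.Perm (Fin 3),
    IsTriangle345 (tripleVertex t (σ 0)) (tripleVertex t (σ 1)) (tripleVertex t (σ 2))
  /-- a triple triangle stands at the place of the vertex that it replaces -/
  triple_place : ∀ t i,
    |(tripleVertex t i).1 - 1000 * (layout.pos (Sum.inr t)).1| ≤ 4 ∧
    |(tripleVertex t i).2 - 1000 * (layout.pos (Sum.inr t)).2| ≤ 4
  two_le_pairs : ∀ p, 2 ≤ pairs p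
  /-- a path starts at the element point -/
  joint_zero : ∀ p, joint p 0 =
    (1000 * (layout.pos (Sum.inl p.elem)).1, 1000 * (layout.pos (Sum.inl p.elem)).2)
  /-- a path ends at the vertex of the triple triangle that represents the element -/
  joint_last : ∀ p, joint p (pairs p) = tripleVertex p.1 p.2
  /-- the first pair is vertical, the second one horizontal, the others are either -/
  first_vertical : ∀ p, IsVertical (joint p 0) (joint p 1)
  second_horizontal : ∀ p, IsHorizontal (joint p 1) (joint p 2)
  pair_345 : ∀ p, ∀ i < pairs p,
    IsVertical (joint p i) (joint p (i + 1)) ∨ IsHorizontal (joint p i) (joint p (i + 1))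
  /-- the three vertices of every triangle lie in three different sets -/
  colour_injective : ∀ a : toTrianglePaths.Triangle,
    Function.Injective fun k => colour (toTrianglePaths.vertex a k)
  /-- the triangles are pairwise different, and form a plane figure: two triangles meet in nothing
  but their common vertices, or a common side. In particular, consecutive pairs of a path are
  connected at one or two vertices, and the first two pairs at just one. -/
  vertexSet_injective : Function.Injective toTrianglePaths.vertexSet
  plane : ∀ a b : toTrianglePaths.Triangle,
    convexHull ℝ (toTrianglePaths.vertexSet a) ∩ convexHull ℝ (toTrianglePaths.vertexSet b) ⊆
      convexHull ℝ (toTrianglePaths.vertexSet a ∩ toTrianglePaths.vertexSet b)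

namespace TrianglePathGraph

variable {X Y Z : Type*} [Fintype X] [Fintype Y] [Fintype Z] {I : P3DM X Y Z}

/-- The points listed in the sets `P_1`, `P_2`, `P_3`, with repetition: the element points, the
vertices of the triple triangles, and the remaining vertices of the triangle paths, where a
vertex that is shared by two paths, or a side corner that is shared by two pairs of one path, is
listed once for each of them. -/
inductive Point (G : TrianglePathGraph I) where
  | elem (e : X ⊕ Y ⊕ Z)
  | triple (t : I.T) (i : Fin 3)
  /-- the place where pair number `i` and pair number `i + 1` are joined -/
  | joint (p : I.Edge) (i : Fin (G.pairs p - 1))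
  /-- one of the two corners on the common diagonal of pair number `i` -/
  | side (p : I.Edge) (i : Fin (G.pairs p)) (b : Bool)

/-- The coordinates of a point. -/
def coord (G : TrianglePathGraph I) : G.Point → ℤ × ℤ
  | .elem e => (1000 * (G.layout.pos (Sum.inl e)).1, 1000 * (G.layout.pos (Sum.inl e)).2)
  | .triple t i => G.tripleVertex t i
  | .joint p i => G.joint p (i + 1)
  | .side p i b => _root_.side (G.joint p i) (G.joint p (i + 1)) b

/-- The three sets `P_1`, `P_2`, `P_3`. -/
def P (G : TrianglePathGraph I) (c : Fin 3) : Set G.Point := {v | G.colour (G.coord v) = c}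

/-- The point at `joint p i`: the element point for `i = 0`, a vertex of the triple triangle for
`i = pairs p`. -/
def jointPoint (G : TrianglePathGraph I) (p : I.Edge) (i : ℕ) : G.Point :=
  if i = 0 then .elem p.elem
  else if h : i - 1 < G.pairs p - 1 then .joint p ⟨i - 1, h⟩
  else .triple p.1 p.2

/-- The `j`-th triangle of the path `p`, counted from the element point, as a set of points. -/
def pathTrianglePoints (G : TrianglePathGraph I) (p : I.Edge) (j : Fin (2 * G.pairs p)) :
    Set G.Point :=
  {G.jointPoint p ((j + 1) / 2), .side p ⟨j / 2, by omega⟩ false, .side p ⟨j / 2, by omega⟩ true}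

/-- Euclidean distance of two points. -/
noncomputable def eDist (G : TrianglePathGraph I) (v w : G.Point) : ℝ :=
  Real.sqrt ((((G.coord v).1 : ℝ) - (G.coord w).1) ^ 2 + (((G.coord v).2 : ℝ) - (G.coord w).2) ^ 2)

/-- The circumference of the triangle spanned by three points. -/
noncomputable def circumference (G : TrianglePathGraph I) (s : Fin 3 → G.Point) : ℝ :=
  G.eDist (s 0) (s 1) + G.eDist (s 0) (s 2) + G.eDist (s 1) (s 2)

/-- `M` is a partition of the points of `P_1`, `P_2`, `P_3` into triples with one point in each of
the three sets. -/
def IsPartition (G : TrianglePathGraph I) (M : Finset (Fin 3 → G.Point)) : Prop :=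
  (∀ s ∈ M, ∀ c, s c ∈ G.P c) ∧ ∀ v : G.Point, ∃! s, s ∈ M ∧ v ∈ Set.range s

/-- The `j`-th triangle of the path `p` is selected by `M`. -/
def Selected (G : TrianglePathGraph I) (M : Finset (Fin 3 → G.Point)) (p : I.Edge)
    (j : Fin (2 * G.pairs p)) : Prop :=
  ∃ s ∈ M, Set.range s = G.pathTrianglePoints p j

/-- `p` is an alternating triangle path under `M`: either the first, third, fifth, … triangles
are exactly those selected, or the second, fourth, sixth, … ones are (the numbers `j` start
at 0). -/
def IsAlternating (G : TrianglePathGraph I) (M : Finset (Fin 3 → G.Point)) (p : I.Edge) : Prop :=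
  (∀ j, G.Selected M p j ↔ Even (j : ℕ)) ∨ (∀ j, G.Selected M p j ↔ Odd (j : ℕ))

/-- There is a pattern of alternating triangles: a partition of the points into `n` triangles, one
vertex in each set, with total circumference `12 n`, under which every triangle path is
alternating. (As the triples of `M` partition each `P_c`, the number `n` is the common cardinality
of `P_1`, `P_2` and `P_3`.) -/
def HasAlternatingPattern (G : TrianglePathGraph I) : Prop :=
  ∃ M : Finset (Fin 3 → G.Point), G.IsPartition M ∧
    ∑ s ∈ M, G.circumference s = 12 * (M.card : ℝ) ∧ ∀ p, G.IsAlternating M p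

end TrianglePathGraph

/-! A side corner, or a joint in the interior of a path, lies in exactly two triangles, which are
consecutive in the path; so selecting the triangles of a path alternately covers each such point
exactly once, whichever of the two parities is chosen. A vertex of a triple triangle lies in that
triangle and in the last triangle of one path, so it is covered exactly once if and only if the
triple triangle is selected exactly when this path selects its first, third, fifth, … triangles.
Hence the three paths at a triple have the same parity, and the element points are covered exactly
once if and only if the triples whose triple triangles are selected form a matching.

The condition on the circumference forces all triples of the partition to be triangles of the
figure: the triples outside the triangle paths consist of element points and vertices of triple
triangles, and points of this kind at different vertices of the scaled layout are at distance at
least 1000 - 2 * 4 = 992. -/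

theorem existsUnique_and_eq_or_eq_iff {α : Type*} {P : α → Prop} {x y : α} (hxy : x ≠ y) :
    (∃! a, P a ∧ (a = x ∨ a = y)) ↔ (P x ↔ ¬P y) := by
  constructor
  · rintro ⟨a, ⟨ha, rfl | rfl⟩, huniq⟩
    · exact iff_of_true ha fun hy => hxy (huniq y ⟨hy, .inr rfl⟩).symm
    · exact iff_of_false (fun hx => hxy (huniq x ⟨hx, .inl rfl⟩)) (not_not_intro ha)
  · intro h
    by_cases hx : P x
    · refine ⟨x, ⟨hx, .inl rfl⟩, ?_⟩
      rintro a ⟨ha, rfl | rfl⟩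
      exacts [rfl, absurd ha (h.1 hx)]
    · refine ⟨y, ⟨not_not.1 (mt h.2 hx), .inr rfl⟩, ?_⟩
      rintro a ⟨ha, rfl | rfl⟩
      exacts [absurd ha hx, rfl]

theorem existsUnique_and_exists_apply_eq_iff {α β : Type*} {f : α → β}
    (hf : Function.Injective f) {P : β → Prop} {Q : α → Prop} :
    (∃! b, P b ∧ ∃ a, Q a ∧ f a = b) ↔ ∃! a, P (f a) ∧ Q a := by
  constructor
  · rintro ⟨_, ⟨hP, a, hQ, rfl⟩, huniq⟩
    exact ⟨a, ⟨hP, hQ⟩, fun a' h => hf (huniq _ ⟨h.1, a', h.2, rfl⟩)⟩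
  · rintro ⟨a, ⟨hP, hQ⟩, huniq⟩
    refine ⟨f a, ⟨hP, a, hQ, rfl⟩, ?_⟩
    rintro _ ⟨hP', a', hQ', rfl⟩
    rw [huniq a' ⟨hP', hQ'⟩]

theorem exists_perm_comp_eq_of_range_eq {ι α : Type*} {f g : ι → α} (hf : Function.Injective f)
    (hg : Function.Injective g) (h : Set.range f = Set.range g) :
    ∃ σ : Equiv.Perm ι, g ∘ σ = f := by
  refine ⟨(Equiv.ofInjective f hf).trans
    ((Equiv.setCongr h).trans (Equiv.ofInjective g hg).symm), funext fun i => ?_⟩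
  simp only [Function.comp, Equiv.trans_apply, Equiv.apply_ofInjective_symm]
  rfl

theorem member_injective {X Y Z : Type*} (t : X × Y × Z) : Function.Injective (member t) := by
  intro i j h
  fin_cases i <;> fin_cases j <;> simp_all [member]

theorem sqrt_sq_add_sq_eq_five {x y : ℤ} (h : (|x| = 3 ∧ |y| = 4) ∨ (|x| = 4 ∧ |y| = 3)) :
    Real.sqrt ((x : ℝ) ^ 2 + (y : ℝ) ^ 2) = 5 := by
  have hxy : x ^ 2 + y ^ 2 = 5 ^ 2 := by
    rw [← sq_abs x, ← sq_abs y]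
    rcases h with ⟨hx, hy⟩ | ⟨hx, hy⟩ <;> rw [hx, hy] <;> norm_num
  have hxy' : (x : ℝ) ^ 2 + (y : ℝ) ^ 2 = 5 ^ 2 := mod_cast hxy
  rw [hxy', Real.sqrt_sq (by norm_num)]

namespace P3DM

variable {X Y Z : Type*} [Fintype X] [Fintype Y] [Fintype Z]

theorem existsUnique_edge_iff {I : P3DM X Y Z} {U : Set I.T} {e : X ⊕ Y ⊕ Z} :
    (∃! p : I.Edge, p.1 ∈ U ∧ p.elem = e) ↔
      ∃! t, t ∈ Subtype.val '' U ∧ ∃ i, member t i = e := by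
  constructor
  · rintro ⟨⟨t, i⟩, ⟨ht, hi⟩, huniq⟩
    refine ⟨t, ⟨⟨t, ht, rfl⟩, i, hi⟩, ?_⟩
    rintro _ ⟨⟨t', ht', rfl⟩, i', hi'⟩
    exact congrArg (fun p : I.Edge => p.1.1) (huniq (t', i') ⟨ht', hi'⟩)
  · rintro ⟨_, ⟨⟨t, ht, rfl⟩, i, hi⟩, huniq⟩
    refine ⟨(t, i), ⟨ht, hi⟩, ?_⟩
    rintro ⟨t', i'⟩ ⟨ht', hi'⟩
    obtain rfl : t' = t := Subtype.ext (huniq t'.1 ⟨⟨t', ht', rfl⟩, i', hi'⟩)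
    exact congrArg _ (member_injective t'.1 (hi'.trans hi.symm))

theorem isYes_iff_exists_existsUnique_edge {I : P3DM X Y Z} :
    I.IsYes ↔ ∃ U : Set I.T, ∀ e, ∃! p : I.Edge, p.1 ∈ U ∧ p.elem = e := by
  simp only [existsUnique_edge_iff]
  constructor
  · rintro ⟨T', hT, h⟩
    refine ⟨{t | t.1 ∈ T'}, ?_⟩
    have hU : Subtype.val '' {t : I.T | t.1 ∈ T'} = T' := by
      ext t
      simpa using @hT t
    simpa only [hU, Finset.mem_coe] using h
  · rintro ⟨U, h⟩
    refine ⟨(U.toFinite.image Subtype.val).toFinset, ?_, ?_⟩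
    · intro t ht
      obtain ⟨t, -, rfl⟩ := (Set.Finite.mem_toFinset _).1 ht
      exact t.2
    · simpa only [Set.Finite.mem_toFinset] using h

end P3DM

namespace TrianglePathGraph

variable {X Y Z : Type*} [Fintype X] [Fintype Y] [Fintype Z] {I : P3DM X Y Z}

section Incidence

variable (G : TrianglePathGraph I)

theorem coord_jointPoint {p : I.Edge} {i : ℕ} (hi : i ≤ G.pairs p) :
    G.coord (G.jointPoint p i) = G.joint p i := by
  have := G.two_le_pairs p
  unfold jointPoint
  split_ifs with h0 hlt
  · rw [h0, joint_zero, coord]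
  · rw [coord, Nat.sub_add_cancel (by omega)]
  · obtain rfl : i = G.pairs p := by omega
    rw [joint_last, coord]

theorem jointPoint_eq_elem_iff {p : I.Edge} {i : ℕ} {e : X ⊕ Y ⊕ Z} :
    G.jointPoint p i = .elem e ↔ i = 0 ∧ p.elem = e := by
  unfold jointPoint
  split_ifs <;> simp_all

theorem jointPoint_eq_triple_iff {p : I.Edge} {i : ℕ} {t : I.T} {k : Fin 3} :
    G.jointPoint p i = .triple t k ↔ G.pairs p ≤ i ∧ p = (t, k) := by
  have := G.two_le_pairs p
  unfold jointPoint
  split_ifs with h0 hlt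
  · simp only [false_iff]
    omega
  · simp only [false_iff]
    omega
  · have : G.pairs p ≤ i := by omega
    simp [this, Prod.ext_iff]

theorem jointPoint_eq_joint_iff {p q : I.Edge} {i : ℕ} {k : Fin (G.pairs q - 1)} :
    G.jointPoint p i = .joint q k ↔ p = q ∧ i = k + 1 := by
  have := k.isLt
  constructor
  · unfold jointPoint
    split_ifs with h0 hlt
    · simp
    · rintro ⟨⟩
      exact ⟨rfl, by grind⟩
    · simp
  · rintro ⟨rfl, rfl⟩
    simp [jointPoint]

theorem jointPoint_ne_side {p q : I.Edge} {i : ℕ} {k : Fin (G.pairs q)} {b : Bool} :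
    G.jointPoint p i ≠ .side q k b := by
  unfold jointPoint
  split_ifs <;> simp

/-- The listed points at the vertices of a triangle, in the order of `vertex`. -/
def corner : G.Triangle → Fin 3 → G.Point
  | .inl ⟨p, j⟩ =>
    ![G.jointPoint p ((j + 1) / 2), .side p ⟨j / 2, by omega⟩ false, .side p ⟨j / 2, by omega⟩ true]
  | .inr t => .triple t

/-- A triangle of the figure as a set of listed points; it extends `pathTrianglePoints` to the
triple triangles. -/
def cornerSet (a : G.Triangle) : Set G.Point := Set.range (G.corner a)

theorem cornerSet_inl (p : I.Edge) (j : Fin (2 * G.pairs p)) :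
    G.cornerSet (.inl ⟨p, j⟩) = G.pathTrianglePoints p j := by
  ext v
  simp only [cornerSet, corner, pathTrianglePoints, Set.mem_range, Fin.exists_fin_succ]
  simp [eq_comm]

theorem coord_corner (a : G.Triangle) (k : Fin 3) :
    G.coord (G.corner a k) = G.vertex a k := by
  rcases a with ⟨p, j⟩ | t
  · fin_cases k
    exacts [G.coord_jointPoint (by omega), rfl, rfl]
  · rfl

theorem cornerSet_injective : Function.Injective G.cornerSet := by
  let plane (v : G.Point) : ℝ × ℝ := ((G.coord v).1, (G.coord v).2)
  have hplane : G.vertexSet = Set.image plane ∘ G.cornerSet := by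
    funext a
    rw [Function.comp_apply, cornerSet, ← Set.range_comp]
    simp only [TrianglePaths.vertexSet, Function.comp_def, plane, coord_corner]
  exact .of_comp (hplane ▸ G.vertexSet_injective)

theorem inl_eq_inl_iff {p q : I.Edge} {j : Fin (2 * G.pairs p)} {k : Fin (2 * G.pairs q)} :
    (Sum.inl ⟨p, j⟩ : G.Triangle) = .inl ⟨q, k⟩ ↔ p = q ∧ (j : ℕ) = k := by
  rw [Sum.inl.injEq, Sigma.mk.injEq]
  exact and_congr_right fun h => by subst h; simp [Fin.ext_iff]

/-- The triangle of a path at its element point. -/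
def firstTriangle (p : I.Edge) : G.Triangle :=
  .inl ⟨p, ⟨0, by have := G.two_le_pairs p; omega⟩⟩

/-- The triangle of a path at the triple triangle. -/
def lastTriangle (p : I.Edge) : G.Triangle :=
  .inl ⟨p, ⟨2 * G.pairs p - 1, by have := G.two_le_pairs p; omega⟩⟩

theorem firstTriangle_injective : Function.Injective G.firstTriangle := fun _ _ h =>
  (G.inl_eq_inl_iff.1 h).1

theorem mem_pathTrianglePoints_iff {v : G.Point} {p : I.Edge} {j : Fin (2 * G.pairs p)} :
    v ∈ G.pathTrianglePoints p j ↔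
      G.jointPoint p ((j + 1) / 2) = v ∨ ∃ b, v = .side p ⟨j / 2, by omega⟩ b := by
  simp [pathTrianglePoints, eq_comm]

theorem elem_mem_cornerSet_iff {e : X ⊕ Y ⊕ Z} {a : G.Triangle} :
    .elem e ∈ G.cornerSet a ↔ ∃ p : I.Edge, p.elem = e ∧ G.firstTriangle p = a := by
  rcases a with ⟨p, j⟩ | t
  · simp only [cornerSet_inl, mem_pathTrianglePoints_iff, jointPoint_eq_elem_iff, firstTriangle,
      inl_eq_inl_iff]
    grind
  · simp [cornerSet, corner, firstTriangle]

theorem triple_mem_cornerSet_iff {t : I.T} {i : Fin 3} {a : G.Triangle} :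
    .triple t i ∈ G.cornerSet a ↔ a = .inr t ∨ a = G.lastTriangle (t, i) := by
  rcases a with ⟨p, j⟩ | t'
  · simp only [cornerSet_inl, mem_pathTrianglePoints_iff, jointPoint_eq_triple_iff, lastTriangle,
      inl_eq_inl_iff]
    grind
  · simp [cornerSet, corner, lastTriangle]

theorem joint_mem_cornerSet_iff {p : I.Edge} {i : Fin (G.pairs p - 1)} {a : G.Triangle} :
    .joint p i ∈ G.cornerSet a ↔
      a = .inl ⟨p, ⟨2 * i + 1, by omega⟩⟩ ∨ a = .inl ⟨p, ⟨2 * i + 2, by omega⟩⟩ := by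
  rcases a with ⟨q, j⟩ | t
  · simp only [cornerSet_inl, mem_pathTrianglePoints_iff, jointPoint_eq_joint_iff, inl_eq_inl_iff]
    grind
  · simp [cornerSet, corner]

theorem side_mem_cornerSet_iff {p : I.Edge} {i : Fin (G.pairs p)} {b : Bool} {a : G.Triangle} :
    .side p i b ∈ G.cornerSet a ↔
      a = .inl ⟨p, ⟨2 * i, by omega⟩⟩ ∨ a = .inl ⟨p, ⟨2 * i + 1, by omega⟩⟩ := by
  rcases a with ⟨q, j⟩ | t
  · simp only [cornerSet_inl, mem_pathTrianglePoints_iff, jointPoint_ne_side, false_or,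
      inl_eq_inl_iff]
    constructor
    · rintro ⟨_, ⟨⟩⟩
      grind
    · intro h
      obtain rfl : q = p := h.elim And.left And.left
      exact ⟨b, congrArg (Point.side q · b) (Fin.ext (by grind))⟩
  · simp [cornerSet, corner]

end Incidence

section Tiling

variable (G : TrianglePathGraph I)

/-- A set of triangles of the figure is a tiling if every listed point belongs to exactly one of
them. Tilings are the partitions of the listed points into triangles of the figure. -/
def IsTiling (S : Set G.Triangle) : Prop := ∀ v, ∃! a, a ∈ S ∧ v ∈ G.cornerSet a

/-- The alternating selection of triangles that contains the triple triangles of the triples in `U`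
and, along each path `p`, the first, third, fifth, … triangles if `p ∈ E`, and the second, fourth,
sixth, … ones otherwise. -/
def selection (U : Set I.T) (E : Set I.Edge) : Set G.Triangle :=
  {a | a.elim (fun b => b.1 ∈ E ↔ Even (b.2 : ℕ)) (· ∈ U)}

variable {G} {U : Set I.T} {E : Set I.Edge}

theorem inl_mem_selection_iff {p : I.Edge} {j : Fin (2 * G.pairs p)} :
    .inl ⟨p, j⟩ ∈ G.selection U E ↔ (p ∈ E ↔ Even (j : ℕ)) := .rfl

theorem inr_mem_selection_iff {t : I.T} : .inr t ∈ G.selection U E ↔ t ∈ U := .rfl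

theorem firstTriangle_mem_selection_iff {p : I.Edge} :
    G.firstTriangle p ∈ G.selection U E ↔ p ∈ E := by
  simp [firstTriangle, inl_mem_selection_iff]

theorem lastTriangle_mem_selection_iff {p : I.Edge} :
    G.lastTriangle p ∈ G.selection U E ↔ p ∉ E := by
  have := G.two_le_pairs p
  have hodd : ¬Even (2 * G.pairs p - 1) := by
    rw [Nat.even_iff]
    omega
  simp [lastTriangle, inl_mem_selection_iff, hodd]

theorem existsUnique_elem_mem_cornerSet_iff {e : X ⊕ Y ⊕ Z} :
    (∃! a, a ∈ G.selection U E ∧ .elem e ∈ G.cornerSet a) ↔ ∃! p : I.Edge, p ∈ E ∧ p.elem = e := by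
  simp only [elem_mem_cornerSet_iff, firstTriangle_mem_selection_iff,
    existsUnique_and_exists_apply_eq_iff G.firstTriangle_injective]

theorem existsUnique_triple_mem_cornerSet_iff {t : I.T} {i : Fin 3} :
    (∃! a, a ∈ G.selection U E ∧ .triple t i ∈ G.cornerSet a) ↔ (t ∈ U ↔ (t, i) ∈ E) := by
  simp only [triple_mem_cornerSet_iff]
  rw [existsUnique_and_eq_or_eq_iff (by simp [lastTriangle]), inr_mem_selection_iff,
    lastTriangle_mem_selection_iff, not_not]

theorem existsUnique_joint_mem_cornerSet (p : I.Edge) (i : Fin (G.pairs p - 1)) :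
    ∃! a, a ∈ G.selection U E ∧ .joint p i ∈ G.cornerSet a := by
  simp only [joint_mem_cornerSet_iff]
  rw [existsUnique_and_eq_or_eq_iff (by simp), inl_mem_selection_iff, inl_mem_selection_iff]
  grind

theorem existsUnique_side_mem_cornerSet (p : I.Edge) (i : Fin (G.pairs p)) (b : Bool) :
    ∃! a, a ∈ G.selection U E ∧ .side p i b ∈ G.cornerSet a := by
  simp only [side_mem_cornerSet_iff]
  rw [existsUnique_and_eq_or_eq_iff (by simp), inl_mem_selection_iff, inl_mem_selection_iff]
  grind

theorem isTiling_selection_iff :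
    G.IsTiling (G.selection U E) ↔
      E = Prod.fst ⁻¹' U ∧ ∀ e, ∃! p : I.Edge, p ∈ E ∧ p.elem = e := by
  constructor
  · intro h
    exact ⟨Set.ext fun p => (existsUnique_triple_mem_cornerSet_iff.1 (h (.triple p.1 p.2))).symm,
      fun e => existsUnique_elem_mem_cornerSet_iff.1 (h (.elem e))⟩
  · rintro ⟨rfl, he⟩ (e | ⟨t, i⟩ | ⟨p, i⟩ | ⟨p, i, b⟩)
    · exact existsUnique_elem_mem_cornerSet_iff.2 (he e)
    · exact existsUnique_triple_mem_cornerSet_iff.2 .rfl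
    · exact existsUnique_joint_mem_cornerSet p i
    · exact existsUnique_side_mem_cornerSet p i b

end Tiling

section Circumference

variable (G : TrianglePathGraph I)

theorem eDist_self (v : G.Point) : G.eDist v v = 0 := by simp [eDist]

theorem eDist_comm (v w : G.Point) : G.eDist v w = G.eDist w v := by
  simp only [eDist, sub_sq_comm]

theorem eDist_nonneg (v w : G.Point) : 0 ≤ G.eDist v w := Real.sqrt_nonneg _

theorem abs_coord_fst_sub_le_eDist (v w : G.Point) :
    |((G.coord v).1 : ℝ) - (G.coord w).1| ≤ G.eDist v w :=
  Real.abs_le_sqrt (le_add_of_nonneg_right (sq_nonneg _))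

theorem abs_coord_snd_sub_le_eDist (v w : G.Point) :
    |((G.coord v).2 : ℝ) - (G.coord w).2| ≤ G.eDist v w :=
  Real.abs_le_sqrt (le_add_of_nonneg_left (sq_nonneg _))

theorem two_mul_circumference (s : Fin 3 → G.Point) :
    2 * G.circumference s = ∑ i, ∑ j, G.eDist (s i) (s j) := by
  simp only [Fin.sum_univ_three, eDist_self, circumference]
  rw [G.eDist_comm (s 1) (s 0), G.eDist_comm (s 2) (s 0), G.eDist_comm (s 2) (s 1)]
  ring

theorem circumference_comp_perm (s : Fin 3 → G.Point) (σ : Equiv.Perm (Fin 3)) :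
    G.circumference (s ∘ σ) = G.circumference s := by
  refine mul_left_cancel₀ (two_ne_zero (α := ℝ)) ?_
  rw [two_mul_circumference, two_mul_circumference,
    ← Equiv.sum_comp σ fun i => ∑ j, G.eDist (s i) (s j)]
  exact Finset.sum_congr rfl fun i _ => Equiv.sum_comp σ fun j => G.eDist (s (σ i)) (s j)

theorem eDist_le_circumference (s : Fin 3 → G.Point) (c d : Fin 3) :
    G.eDist (s c) (s d) ≤ G.circumference s := by
  have h01 := G.eDist_nonneg (s 0) (s 1)
  have h02 := G.eDist_nonneg (s 0) (s 2)
  have h12 := G.eDist_nonneg (s 1) (s 2)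
  unfold circumference
  fin_cases c <;> fin_cases d <;> grind [eDist_self, eDist_comm]

variable {G}

theorem circumference_eq_twelve_of_isTriangle345 {s : Fin 3 → G.Point}
    (h : IsTriangle345 (G.coord (s 0)) (G.coord (s 1)) (G.coord (s 2))) :
    G.circumference s = 12 := by
  obtain ⟨hhor, hver, hlegs⟩ := h
  have h01 : G.eDist (s 0) (s 1) = |(((G.coord (s 1)).1 - (G.coord (s 0)).1 : ℤ) : ℝ)| := by
    rw [eDist_comm, eDist, hhor, sub_self, zero_pow two_ne_zero, add_zero, Real.sqrt_sq_eq_abs,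
      Int.cast_sub]
  have h02 : G.eDist (s 0) (s 2) = |(((G.coord (s 2)).2 - (G.coord (s 0)).2 : ℤ) : ℝ)| := by
    rw [eDist_comm, eDist, hver, sub_self, zero_pow two_ne_zero, zero_add, Real.sqrt_sq_eq_abs,
      Int.cast_sub]
  have h12 : G.eDist (s 1) (s 2) = 5 := by
    rw [← sqrt_sq_add_sq_eq_five hlegs, eDist, hhor, hver, Int.cast_sub, Int.cast_sub,
      sub_sq_comm ((G.coord (s 0)).2 : ℝ)]
  rw [circumference, h01, h02, h12, ← Int.cast_abs, ← Int.cast_abs]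
  rcases hlegs with ⟨ha, hb⟩ | ⟨ha, hb⟩ <;> rw [ha, hb] <;> norm_num

variable (G) in
theorem circumference_corner (a : G.Triangle) : G.circumference (G.corner a) = 12 := by
  rcases a with ⟨p, j⟩ | t
  · have hpair := G.pair_345 p (j / 2) (by omega)
    unfold IsVertical IsHorizontal at hpair
    obtain hj | hj : ((j : ℕ) + 1) / 2 = j / 2 ∨ ((j : ℕ) + 1) / 2 = j / 2 + 1 := by omega
    -- The leg from `joint p i` to its `false` side corner is vertical, whence the transposition.
    · rw [← G.circumference_comp_perm _ (Equiv.swap 1 2)]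
      apply circumference_eq_twelve_of_isTriangle345
      simp only [Function.comp, coord_corner, TrianglePaths.vertex, TrianglePaths.pathTriangle, hj]
      simpa [IsTriangle345, side, Equiv.swap_apply_def] using hpair
    · apply circumference_eq_twelve_of_isTriangle345
      simp only [coord_corner, TrianglePaths.vertex, TrianglePaths.pathTriangle, hj]
      simpa [IsTriangle345, side, abs_sub_comm] using hpair
  · obtain ⟨σ, hσ⟩ := G.triple_345 t
    rw [← G.circumference_comp_perm _ σ]
    exact circumference_eq_twelve_of_isTriangle345 hσ

variable (G) in
theorem colour_coord_corner_injective (a : G.Triangle) :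
    Function.Injective fun k => G.colour (G.coord (G.corner a k)) := by
  simpa only [coord_corner] using G.colour_injective a

theorem circumference_eq_twelve_of_range_eq_cornerSet {s : Fin 3 → G.Point}
    (hs : Function.Injective s) {a : G.Triangle} (h : Set.range s = G.cornerSet a) :
    G.circumference s = 12 := by
  have hcorner : Function.Injective (G.corner a) :=
    .of_comp (f := G.colour ∘ G.coord) (G.colour_coord_corner_injective a)
  obtain ⟨σ, rfl⟩ := exists_perm_comp_eq_of_range_eq hs hcorner h
  rw [circumference_comp_perm, circumference_corner]

end Circumference

section Site

variable {G : TrianglePathGraph I}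

/-- The vertex of the layout at whose place an element point or a vertex of a triple triangle
stands; the points that belong to triangle paths only have none. -/
def Point.site : G.Point → Option ((X ⊕ Y ⊕ Z) ⊕ I.T)
  | .elem e => some (.inl e)
  | .triple t _ => some (.inr t)
  | .joint _ _ => none
  | .side _ _ _ => none

theorem abs_coord_sub_le_four_of_site_eq {v : G.Point} {z : (X ⊕ Y ⊕ Z) ⊕ I.T}
    (h : v.site = some z) :
    |(G.coord v).1 - 1000 * (G.layout.pos z).1| ≤ 4 ∧
      |(G.coord v).2 - 1000 * (G.layout.pos z).2| ≤ 4 := by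
  cases v with
  | elem e =>
    obtain rfl := Option.some.inj h
    simp [coord]
  | triple t i =>
    obtain rfl := Option.some.inj h
    exact G.triple_place t i
  | joint p i => cases h
  | side p i b => cases h

theorem le_eDist_of_site_ne {v w : G.Point} {y z : (X ⊕ Y ⊕ Z) ⊕ I.T} (hv : v.site = some y)
    (hw : w.site = some z) (hyz : y ≠ z) : 992 ≤ G.eDist v w := by
  have hvy := abs_coord_sub_le_four_of_site_eq hv
  have hwz := abs_coord_sub_le_four_of_site_eq hw
  simp only [abs_le] at hvy hwz
  have hpos : (G.layout.pos y).1 ≠ (G.layout.pos z).1 ∨ (G.layout.pos y).2 ≠ (G.layout.pos z).2 :=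
    not_and_or.1 fun h => hyz (G.layout.pos_injective (Prod.ext h.1 h.2))
  rcases hpos with hne | hne
  · have hfst : 992 ≤ |(G.coord v).1 - (G.coord w).1| := le_abs.2 (by omega)
    exact le_trans (mod_cast hfst) (G.abs_coord_fst_sub_le_eDist v w)
  · have hsnd : 992 ≤ |(G.coord v).2 - (G.coord w).2| := le_abs.2 (by omega)
    exact le_trans (mod_cast hsnd) (G.abs_coord_snd_sub_le_eDist v w)

theorem exists_range_eq_cornerSet_of_site_eq {s : Fin 3 → G.Point} (hs : Function.Injective s)
    {z : (X ⊕ Y ⊕ Z) ⊕ I.T} (hz : ∀ c, (s c).site = some z) :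
    ∃ a, Set.range s = G.cornerSet a := by
  cases z with
  | inl e =>
    have helem (c : Fin 3) : s c = .elem e := by
      have := hz c
      cases hc : s c <;> simp_all [Point.site]
    exact absurd (hs ((helem 0).trans (helem 1).symm)) (by decide)
  | inr t =>
    have htriple (c : Fin 3) : ∃ i, s c = .triple t i := by
      have := hz c
      cases hc : s c <;> simp_all [Point.site]
    choose f hf using htriple
    have hinj : Function.Injective f := fun c d hcd => hs (by rw [hf, hf, hcd])
    have hcomp : s = G.corner (.inr t) ∘ f := funext hf
    exact ⟨.inr t, by rw [hcomp, (Finite.surjective_of_injective hinj).range_comp, cornerSet]⟩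

theorem exists_range_eq_cornerSet_or_twelve_lt_circumference_of_site_ne_none
    {s : Fin 3 → G.Point} (hs : Function.Injective s) (hsite : ∀ c, (s c).site ≠ none) :
    (∃ a, Set.range s = G.cornerSet a) ∨ 12 < G.circumference s := by
  choose z hz using fun c => Option.ne_none_iff_exists'.1 (hsite c)
  by_cases hconst : ∀ c, z c = z 0
  · exact .inl (exists_range_eq_cornerSet_of_site_eq hs fun c => hconst c ▸ hz c)
  · obtain ⟨c, hc⟩ := not_forall.1 hconst
    have hfar : 992 ≤ G.circumference s :=
      (le_eDist_of_site_ne (hz c) (hz 0) hc).trans (G.eDist_le_circumference s c 0)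
    exact .inr (lt_of_lt_of_le (by norm_num) hfar)

end Site

section Pattern

variable {G : TrianglePathGraph I} {M : Finset (Fin 3 → G.Point)}

theorem injective_of_forall_mem_P {s : Fin 3 → G.Point} (hs : ∀ c, s c ∈ G.P c) :
    Function.Injective s :=
  Function.LeftInverse.injective (g := fun v => G.colour (G.coord v)) hs

theorem IsPartition.eq_of_mem_range (hM : G.IsPartition M) {r s : Fin 3 → G.Point} (hr : r ∈ M)
    (hs : s ∈ M) {v : G.Point} (hvr : v ∈ Set.range r) (hvs : v ∈ Set.range s) : r = s :=
  (hM.2 v).unique ⟨hr, hvr⟩ ⟨hs, hvs⟩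

/-- The triangles of the figure that occur in a set of triples of points. -/
def selected (M : Finset (Fin 3 → G.Point)) : Set G.Triangle :=
  {a | ∃ s ∈ M, Set.range s = G.cornerSet a}

/-- All triples of the set are triangles of the figure. -/
def ConsistsOfTriangles (M : Finset (Fin 3 → G.Point)) : Prop :=
  ∀ s ∈ M, ∃ a, Set.range s = G.cornerSet a

theorem selected_iff_inl_mem_selected {p : I.Edge} {j : Fin (2 * G.pairs p)} :
    G.Selected M p j ↔ .inl ⟨p, j⟩ ∈ selected M := by
  simp only [Selected, selected, Set.mem_ofPred_eq, cornerSet_inl]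

theorem isAlternating_iff_exists_selected_iff {p : I.Edge} :
    G.IsAlternating M p ↔ ∃ P : Prop, ∀ j, G.Selected M p j ↔ (P ↔ Even (j : ℕ)) := by
  constructor
  · rintro (h | h)
    · exact ⟨True, by simpa using h⟩
    · exact ⟨False, by simpa using h⟩
  · rintro ⟨P, h⟩
    by_cases hP : P
    · exact .inl (by simpa [hP] using h)
    · exact .inr (by simpa [hP] using h)

theorem forall_isAlternating_iff_exists_selected_eq :
    (∀ p, G.IsAlternating M p) ↔ ∃ U E, selected M = G.selection U E := by
  simp only [isAlternating_iff_exists_selected_iff, selected_iff_inl_mem_selected]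
  constructor
  · intro h
    choose E hE using h
    refine ⟨{t | .inr t ∈ selected M}, {p | E p}, Set.ext ?_⟩
    rintro (⟨p, j⟩ | t)
    exacts [hE p j, .rfl]
  · rintro ⟨U, E, h⟩ p
    exact ⟨p ∈ E, fun j => by rw [h, inl_mem_selection_iff]⟩

theorem exists_mem_selected_of_site_eq_none (halt : ∀ p, G.IsAlternating M p) {v : G.Point}
    (hv : v.site = none) : ∃ a ∈ selected M, v ∈ G.cornerSet a := by
  obtain ⟨U, E, hUE⟩ := forall_isAlternating_iff_exists_selected_eq.1 halt
  rw [hUE]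
  cases v with
  | elem e => cases hv
  | triple t i => cases hv
  | joint p i => exact (existsUnique_joint_mem_cornerSet p i).exists
  | side p i b => exact (existsUnique_side_mem_cornerSet p i b).exists

theorem IsPartition.exists_range_eq_cornerSet_or_twelve_lt_circumference (hM : G.IsPartition M)
    (halt : ∀ p, G.IsAlternating M p) {s : Fin 3 → G.Point} (hs : s ∈ M) :
    (∃ a, Set.range s = G.cornerSet a) ∨ 12 < G.circumference s := by
  by_cases hsite : ∀ c, (s c).site ≠ none
  · exact exists_range_eq_cornerSet_or_twelve_lt_circumference_of_site_ne_none
      (injective_of_forall_mem_P (hM.1 s hs)) hsite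
  · push Not at hsite
    obtain ⟨c, hc⟩ := hsite
    obtain ⟨a, ⟨r, hr, hra⟩, hca⟩ := exists_mem_selected_of_site_eq_none halt hc
    obtain rfl : s = r := hM.eq_of_mem_range hs hr ⟨c, rfl⟩ (hra ▸ hca)
    exact .inl ⟨a, hra⟩

theorem IsPartition.sum_circumference_eq_iff (hM : G.IsPartition M)
    (halt : ∀ p, G.IsAlternating M p) :
    ∑ s ∈ M, G.circumference s = 12 * (M.card : ℝ) ↔ ConsistsOfTriangles M := by
  have htriangle {s} (hs : s ∈ M) (h : ∃ a, Set.range s = G.cornerSet a) :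
      G.circumference s = 12 :=
    h.elim fun _ => circumference_eq_twelve_of_range_eq_cornerSet
      (injective_of_forall_mem_P (hM.1 s hs))
  have hdichotomy {s} (hs : s ∈ M) :=
    hM.exists_range_eq_cornerSet_or_twelve_lt_circumference halt hs
  have htwelve : ∀ s ∈ M, 12 ≤ G.circumference s := fun s hs =>
    (hdichotomy hs).elim (fun h => (htriangle hs h).ge) le_of_lt
  have hconst : 12 * (M.card : ℝ) = ∑ s ∈ M, 12 := by
    rw [Finset.sum_const, nsmul_eq_mul, mul_comm]
  rw [hconst, eq_comm, Finset.sum_eq_sum_iff_of_le htwelve]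
  exact forall₂_congr fun s hs =>
    ⟨fun h => (hdichotomy hs).resolve_right h.not_lt, fun h => (htriangle hs h).symm⟩

theorem IsPartition.isTiling_selected (hM : G.IsPartition M) (h : ConsistsOfTriangles M) :
    G.IsTiling (selected M) := by
  intro v
  obtain ⟨s, hs, hvs⟩ := (hM.2 v).exists
  obtain ⟨a, ha⟩ := h s hs
  refine ⟨a, ⟨⟨s, hs, ha⟩, ha ▸ hvs⟩, ?_⟩
  rintro b ⟨⟨r, hr, hb⟩, hvb⟩
  obtain rfl : r = s := hM.eq_of_mem_range hr hs (hb ▸ hvb) hvs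
  exact G.cornerSet_injective (hb.symm.trans ha)

variable (G) in
theorem exists_forall_mem_P_and_range_eq_cornerSet (a : G.Triangle) :
    ∃ s : Fin 3 → G.Point, (∀ c, s c ∈ G.P c) ∧ Set.range s = G.cornerSet a := by
  let σ : Equiv.Perm (Fin 3) :=
    .ofBijective _ (Finite.injective_iff_bijective.1 (G.colour_coord_corner_injective a))
  exact ⟨G.corner a ∘ σ.symm, σ.apply_symm_apply, σ.symm.surjective.range_comp _⟩

theorem IsTiling.exists_isPartition {S : Set G.Triangle} (hS : G.IsTiling S) :
    ∃ M, G.IsPartition M ∧ ConsistsOfTriangles M ∧ selected M = S := by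
  choose s hsP hs using G.exists_forall_mem_P_and_range_eq_cornerSet
  let M : Finset (Fin 3 → G.Point) := (S.toFinite.image s).toFinset
  have hM {r : Fin 3 → G.Point} : r ∈ M ↔ ∃ a ∈ S, s a = r := Set.Finite.mem_toFinset _
  refine ⟨M, ⟨fun r hr => ?_, fun v => ?_⟩, fun r hr => ?_, Set.ext fun a => ?_⟩
  · obtain ⟨a, -, rfl⟩ := hM.1 hr
    exact hsP a
  · obtain ⟨a, ⟨ha, hva⟩, huniq⟩ := hS v
    refine ⟨s a, ⟨hM.2 ⟨a, ha, rfl⟩, hs a ▸ hva⟩, ?_⟩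
    rintro r ⟨hr, hvr⟩
    obtain ⟨b, hb, rfl⟩ := hM.1 hr
    rw [huniq b ⟨hb, hs b ▸ hvr⟩]
  · obtain ⟨a, -, rfl⟩ := hM.1 hr
    exact ⟨a, hs a⟩
  · constructor
    · rintro ⟨r, hr, hra⟩
      obtain ⟨b, hb, rfl⟩ := hM.1 hr
      rwa [← G.cornerSet_injective ((hs b).symm.trans hra)]
    · exact fun ha => ⟨s a, hM.2 ⟨a, ha, rfl⟩, hs a⟩

variable (G) in
theorem hasAlternatingPattern_iff_exists_isTiling :
    G.HasAlternatingPattern ↔ ∃ U E, G.IsTiling (G.selection U E) := by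
  constructor
  · rintro ⟨M, hM, hsum, halt⟩
    obtain ⟨U, E, hUE⟩ := forall_isAlternating_iff_exists_selected_eq.1 halt
    exact ⟨U, E, hUE ▸ hM.isTiling_selected ((hM.sum_circumference_eq_iff halt).1 hsum)⟩
  · rintro ⟨U, E, htiling⟩
    obtain ⟨M, hM, htriangles, hUE⟩ := htiling.exists_isPartition
    have halt := forall_isAlternating_iff_exists_selected_eq.2 ⟨U, E, hUE⟩
    exact ⟨M, hM, (hM.sum_circumference_eq_iff halt).2 htriangles, halt⟩

end Pattern

end TrianglePathGraph

theorem proposition1 {X Y Z : Type*} [Fintype X] [Fintype Y] [Fintype Z] (I : P3DM X Y Z)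
    (G : TrianglePathGraph I) : G.HasAlternatingPattern ↔ I.IsYes := by
  rw [G.hasAlternatingPattern_iff_exists_isTiling, P3DM.isYes_iff_exists_existsUnique_edge]
  simp only [TrianglePathGraph.isTiling_selection_iff, exists_eq_left, Set.mem_preimage]
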